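/- Let $X$ be an ordered Banach space, i.e. a real Banach space with the partial order $x\le y\iff y-x\in K$ induced by a convex cone $K\subseteq X$ (with $0 \in K$ and $K\cap(-K)=\{0\}$), and let $K'$ be the set of all continuous linear functionals $\varphi$ on $X$ with $\varphi(x)\ge 0$ for all $x\in K$. For $\varphi\in K'$ put $$p_\varphi(x)=\inf\{\varphi(y) : y\in X,\ y\ge 0,\ y\ge x\}\qquad(x\in X),$$ where $\inf\emptyset=+\infty$. A linear operator $A\colon X\supseteq\mathcal D(A)\to X$ is called $p_\varphi$-dissipative if for every $x\in\mathcal D(A)$ there is $\psi\in K'$ such that $\psi(y)\le p_\varphi(y)$ for all $y\in X$, $\psi(x)=p_\varphi(x)$, and $\psi(Ax)\le 0$. A nonempty set $\Phi\subseteq K'$ is called total if every $x\in X$ with $\varphi(x)\ge 0$ for all $\varphi\in\Phi$ satisfies $x\ge 0$. **Theorem.** Let $A\colon X\supseteq\mathcal D(A)\to X$ be the generator of a strongly continuous semigroup $(T(t))_{t\ge0}$ of bounded linear operators on $X$. Suppose that $A$ is $p_\varphi$-dissipative for every $\varphi$ in some total set $\Phi\subseteq K'$, and that $I-\lambda A\colon\mathcal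 D(A)\to X$ is invertible (bijective) for some $\lambda\ge 0$. Then $T(t)$ is positive for every $t\ge 0$, i.e. $T(t)x\ge 0$ whenever $x\ge 0$. -/

import Mathlib

open Filter Topology
open scoped NNReal

namespace OrderedSemigroup

section Order

variable {X : Type*} [NormedAddCommGroup X] [NormedSpace ℝ X] [PartialOrder X]

/-- The dual cone `K'` of `K = {x | 0 ≤ x}`: the continuous linear functionals on `X` that are
nonnegative on `K`. -/
def dualCone (X : Type*) [NormedAddCommGroup X] [NormedSpace ℝ X] [PartialOrder X] :
    Set (StrongDual ℝ X) :=
  {φ | ∀ x : X, 0 ≤ x → 0 ≤ φ x}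

/-- The sublinear function `p_φ(x) = inf {φ(y) : y ≥ 0, y ≥ x}`. The infimum is taken in the
extended reals, so that it is `+∞` when `0` and `x` have no common upper bound. -/
noncomputable def pFun (φ : StrongDual ℝ X) (x : X) : EReal :=
  sInf ((fun y : X => ((φ y : ℝ) : EReal)) '' {y : X | 0 ≤ y ∧ x ≤ y})

/-- The subdifferential `dp(x)` of `p` at `x`: all `x' ∈ K'` with `x'(y) ≤ p(y)` for every `y`
and `x'(x) = p(x)`. -/
def subdifferential (p : X → EReal) (x : X) : Set (StrongDual ℝ X) :=
  {x' | x' ∈ dualCone X ∧ (∀ y : X, ((x' y : ℝ) : EReal) ≤ p y) ∧ ((x' x : ℝ) : EReal) = p x}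

/-- The operator `A` with domain `A.domain` is `p`-dissipative: for every `x` in the domain there
is `y' ∈ dp(x)` with `y'(A x) ≤ 0`. -/
def IsDissipative (p : X → EReal) (A : X →ₗ.[ℝ] X) : Prop :=
  ∀ x : A.domain, ∃ y' ∈ subdifferential p (x : X), y' (A x) ≤ 0

/-- A total set: a nonempty subset `Φ` of `K'` such that `φ(x) ≥ 0` for all `φ ∈ Φ` implies
`x ≥ 0`. -/
structure IsTotal (Φ : Set (StrongDual ℝ X)) : Prop where
  subset_dualCone : Φ ⊆ dualCone X
  nonempty : Φ.Nonempty
  nonneg_of_forall : ∀ x : X, (∀ φ ∈ Φ, 0 ≤ φ x) → 0 ≤ x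

end Order

section Semigroup

variable {X : Type*} [NormedAddCommGroup X] [NormedSpace ℝ X]

/-- A strongly continuous one-parameter semigroup of bounded operators. -/
structure IsC0Semigroup (T : ℝ≥0 → X →L[ℝ] X) : Prop where
  map_zero : T 0 = ContinuousLinearMap.id ℝ X
  map_add : ∀ s t : ℝ≥0, T (s + t) = (T s).comp (T t)
  continuous_orbit : ∀ x : X, Continuous fun t : ℝ≥0 => T t x

/-- `A` is the (infinitesimal) generator of `T`: its domain consists of all `x` for which
`t⁻¹ (T(t) x - x)` converges in norm as `t → 0+`, and `A x` is that limit. -/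
structure IsGenerator (T : ℝ≥0 → X →L[ℝ] X) (A : X →ₗ.[ℝ] X) : Prop where
  mem_domain_iff : ∀ x : X, x ∈ A.domain ↔
    ∃ y : X, Tendsto (fun t : ℝ≥0 => (t : ℝ)⁻¹ • (T t x - x)) (𝓝[>] 0) (𝓝 y)
  tendsto_apply : ∀ x : A.domain,
    Tendsto (fun t : ℝ≥0 => (t : ℝ)⁻¹ • (T t (x : X) - (x : X))) (𝓝[>] 0) (𝓝 (A x))

end Semigroup

end OrderedSemigroup

/-! Dissipativity for a total family is a minimum principle: for `ω > 0`, `ω v - A v ≥ 0` forces `v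
≥ 0`. The moments `m_n = ∫₀^∞ tⁿ exp (-ω t) T(t) x dt` satisfy `(ω - A) m_0 = x` and `(ω - A)
m_{n+1} = (n + 1) m_n` for large `ω`, so induction makes them all positive (`laplaceMoment_nonneg`).

Positivity of `T(s) x` is recovered as in Post–Widder inversion. Taking `ω = n / s + const` turns
`tⁿ exp (-ω t)` into the `n`-th power of `t exp (-t / s)` times a fixed damping. These powers
concentrate at `t = s`, so a negative value of `φ (T(s) x)` would make some moment negative
(`nonneg_of_integral_mul_exp_pow_nonneg`). -/

namespace OrderedSemigroup

open MeasureTheory Set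

/-! ### Minimum principle -/

section Positivity

variable {X : Type*} [NormedAddCommGroup X] [NormedSpace ℝ X] [PartialOrder X]

/-- A `p_φ`-dissipative operator satisfies a weak minimum principle: if `ω v - A v ≥ 0` for some
`ω > 0`, then `φ v ≥ 0`. -/
theorem IsDissipative.apply_nonneg [IsOrderedAddMonoid X] {φ : StrongDual ℝ X}
    (hφ : φ ∈ dualCone X) {A : X →ₗ.[ℝ] X} (hA : IsDissipative (pFun φ) A) {ω : ℝ} (hω : 0 < ω)
    (v : A.domain) (hv : 0 ≤ ω • (v : X) - A v) : 0 ≤ φ v := by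
  -- Using `-v` gives `ψ (A v) ≥ 0`, hence `ψ v ≥ 0`; and `φ (-v) ≤ p_φ(-v) = ψ (-v)` gives `φ v ≥ ψ
  -- v`.
  obtain ⟨ψ, ⟨hψ, -, hψv⟩, hψA⟩ := hA (-v)
  have h1 := hψ _ hv
  rw [LinearPMap.map_neg, map_neg] at hψA
  rw [map_sub, map_smul, smul_eq_mul] at h1
  have h2 : 0 ≤ ψ v := by
    by_contra! h
    nlinarith
  have h3 : ((φ (-(v : X)) : ℝ) : EReal) ≤ pFun φ (-(v : X)) := by
    refine le_sInf ?_
    rintro _ ⟨y, ⟨-, hy⟩, rfl⟩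
    have := hφ _ (sub_nonneg.2 hy)
    rw [map_sub] at this
    exact EReal.coe_le_coe_iff.2 (by linarith)
  rw [NegMemClass.coe_neg] at hψv
  rw [← hψv, EReal.coe_le_coe_iff, map_neg, map_neg] at h3
  linarith

end Positivity

/-! ### Differentiating tail integrals -/

section Moments

variable {X : Type*} [NormedAddCommGroup X] [NormedSpace ℝ X]

theorem hasDerivWithinAt_integral_Ioi [CompleteSpace X] {g : ℝ → X} (hg : Continuous g)
    (hi : IntegrableOn g (Ioi 0)) :
    HasDerivWithinAt (fun h : ℝ => ∫ t in Ioi h, g t) (-g 0) (Ioi 0) 0 := by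
  have h1 : HasDerivWithinAt (fun h : ℝ => (∫ t in Ioi 0, g t) - ∫ t in (0 : ℝ)..h, g t)
      (-g 0) (Ioi 0) 0 := by
    have := (intervalIntegral.integral_hasDerivAt_right (hg.intervalIntegrable 0 0)
      (hg.stronglyMeasurableAtFilter _ _) hg.continuousAt).hasDerivWithinAt (s := Ioi 0)
    exact this.const_sub _
  refine h1.congr (fun h hh => ?_) (by simp)
  have hh : (0 : ℝ) ≤ h := le_of_lt hh
  rw [intervalIntegral.integral_of_le hh, eq_sub_iff_add_eq, add_comm,
    ← setIntegral_union (Ioc_disjoint_Ioi le_rfl) measurableSet_Ioi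
      (hi.mono_set Ioc_subset_Ioi_self) (hi.mono_set (Ioi_subset_Ioi hh)),
    Ioc_union_Ioi_eq_Ioi hh]

/-- The weight vanishes at the moving endpoint, so there is no boundary term. Replacing `t - h` by
`max (t - h) 0` fixes the domain, and dominated convergence applies. -/
theorem hasDerivWithinAt_integral_Ioi_sub_pow_smul {g : ℝ → X} (hg : Continuous g) (n : ℕ)
    (hi : IntegrableOn (fun t => t ^ n • g t) (Ioi 0))
    (hi' : IntegrableOn (fun t => t ^ (n + 1) • g t) (Ioi 0)) :
    HasDerivWithinAt (fun h : ℝ => ∫ t in Ioi h, (t - h) ^ (n + 1) • g t)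
      (-((n + 1 : ℝ) • ∫ t in Ioi 0, t ^ n • g t)) (Ioi 0) 0 := by
  have hbound : ∀ h t : ℝ, 0 < h → 0 < t →
      |max (t - h) 0 ^ (n + 1) - t ^ (n + 1)| ≤ h * ((n + 1) * t ^ n) := by
    intro h t hh ht
    have hm : |max (t - h) 0| ≤ t := by
      rw [abs_of_nonneg (le_max_right _ _)]
      exact max_le (by linarith) ht.le
    have hd : |max (t - h) 0 - t| ≤ h := by
      rw [abs_le]
      constructor
      · linarith [le_max_left (t - h) 0]
      · linarith [abs_le.1 hm |>.2]
    refine (abs_pow_sub_pow_le _ _ _).trans ?_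
    rw [abs_of_pos ht, max_eq_right hm, mul_assoc]
    push_cast
    gcongr
  have heq : ∀ h : ℝ, 0 ≤ h → ∫ t in Ioi h, (t - h) ^ (n + 1) • g t =
      ∫ t in Ioi 0, max (t - h) 0 ^ (n + 1) • g t := by
    intro h hh
    rw [setIntegral_eq_of_subset_of_forall_sdiff_eq_zero (s := Ioi h) (t := Ioi 0)
      measurableSet_Ioi (Ioi_subset_Ioi hh)]
    · refine setIntegral_congr_fun measurableSet_Ioi fun t ht => ?_
      simp only [mem_Ioi] at ht
      simp only [max_eq_left (sub_nonneg.2 ht.le)]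
    · rintro t ⟨-, ht⟩
      simp only [mem_Ioi, not_lt] at ht
      simp [max_eq_right (sub_nonpos.2 ht)]
  have hint : ∀ h : ℝ, 0 < h →
      IntegrableOn (fun t => max (t - h) 0 ^ (n + 1) • g t) (Ioi 0) := by
    intro h hh
    refine Integrable.mono hi' (by fun_prop) ?_
    refine (ae_restrict_iff' measurableSet_Ioi).2 (Eventually.of_forall fun t ht => ?_)
    have ht : 0 < t := ht
    rw [norm_smul, norm_smul]
    gcongr
    rw [Real.norm_of_nonneg (by positivity), Real.norm_of_nonneg (by positivity)]
    gcongr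
    exact max_le (by linarith) ht.le
  rw [hasDerivWithinAt_iff_tendsto_slope' self_notMem_Ioi, ← integral_smul, ← integral_neg]
  have key : Tendsto (fun h : ℝ => ∫ t in Ioi 0,
      (h⁻¹ * (max (t - h) 0 ^ (n + 1) - t ^ (n + 1))) • g t) (𝓝[>] 0)
      (𝓝 (∫ t in Ioi 0, -((n + 1 : ℝ) • t ^ n • g t))) := by
    refine tendsto_integral_filter_of_dominated_convergence
      (fun t => (n + 1 : ℝ) * ‖t ^ n • g t‖) ?_ ?_ (hi.norm.const_mul _) ?_
    · exact Eventually.of_forall fun h => by fun_prop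
    · filter_upwards [self_mem_nhdsWithin] with h hh
      refine (ae_restrict_iff' measurableSet_Ioi).2 (Eventually.of_forall fun t ht => ?_)
      have hh : 0 < h := hh
      have ht : 0 < t := ht
      rw [norm_smul, norm_smul, ← mul_assoc]
      gcongr
      rw [norm_mul, norm_inv, Real.norm_of_nonneg hh.le, Real.norm_eq_abs,
        Real.norm_of_nonneg (by positivity), inv_mul_le_iff₀ hh]
      exact hbound h t hh ht
    · refine (ae_restrict_iff' measurableSet_Ioi).2 (Eventually.of_forall fun t ht => ?_)
      have ht : 0 < t := ht
      have hd : HasDerivAt (fun h : ℝ => (t - h) ^ (n + 1)) (-((n + 1 : ℝ) * t ^ n)) 0 := by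
        exact (((hasDerivAt_id (0 : ℝ)).const_sub t).fun_pow (n + 1)).congr_deriv (by simp)
      have hs := (hasDerivWithinAt_iff_tendsto_slope' self_notMem_Ioi).1
        (hd.hasDerivWithinAt (s := Ioi 0))
      rw [← smul_assoc, ← neg_smul, smul_eq_mul]
      refine Tendsto.smul_const ?_ _
      refine hs.congr' ?_
      filter_upwards [nhdsWithin_le_nhds (Iio_mem_nhds ht)] with h hh
      have hh : h < t := hh
      rw [slope_def_field, max_eq_left (by linarith)]
      simp [div_eq_inv_mul]
  refine key.congr' ?_
  filter_upwards [self_mem_nhdsWithin] with h hh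
  have hh : 0 < h := hh
  rw [slope_def_module, heq h hh.le]
  simp only [sub_zero]
  rw [← integral_sub (hint h hh) hi', ← integral_smul]
  simp only [← sub_smul, smul_smul]

end Moments

/-! ### Exponential growth bound -/

section Semigroup

variable {X : Type*} [NormedAddCommGroup X] [NormedSpace ℝ X] [CompleteSpace X]

theorem IsC0Semigroup.exists_norm_le_exp {T : ℝ≥0 → X →L[ℝ] X} (hT : IsC0Semigroup T) :
    ∃ M a : ℝ, 0 ≤ M ∧ 0 ≤ a ∧ ∀ t : ℝ≥0, ‖T t‖ ≤ M * Real.exp (a * t) := by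
  obtain ⟨C, hC⟩ := banach_steinhaus (g := fun t : Icc (0 : ℝ≥0) 1 => T t) fun x => by
    obtain ⟨C, hC⟩ := isCompact_Icc.exists_bound_of_continuousOn
      (hT.continuous_orbit x).continuousOn (s := Icc (0 : ℝ≥0) 1)
    exact ⟨C, fun t => hC t t.2⟩
  set M := max C 1
  have hM : 1 ≤ M := le_max_right _ _
  have hM0 : 0 < M := by linarith
  have hpow : ∀ n : ℕ, ∀ t : ℝ≥0, t ≤ n → ‖T t‖ ≤ M ^ n := by
    intro n
    induction n with
    | zero =>
      intro t ht
      obtain rfl : t = 0 := by simpa using ht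
      rw [hT.map_zero, pow_zero]
      exact ContinuousLinearMap.norm_id_le
    | succ n ih =>
      intro t ht
      have h1 : ‖T (min t 1)‖ ≤ M :=
        (hC ⟨min t 1, by simp⟩).trans (le_max_left _ _)
      have h2 : ‖T (t - 1)‖ ≤ M ^ n := ih _ (by
        rw [tsub_le_iff_right]; exact_mod_cast ht)
      have h3 : t = min t 1 + (t - 1) := by
        rcases le_total t 1 with h | h
        · rw [min_eq_left h, tsub_eq_zero_of_le h, add_zero]
        · rw [min_eq_right h, add_tsub_cancel_of_le h]
      rw [h3, hT.map_add, pow_succ']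
      exact (ContinuousLinearMap.opNorm_comp_le _ _).trans (by gcongr)
  refine ⟨M, Real.log M, hM0.le, Real.log_nonneg hM, fun t => ?_⟩
  refine (hpow ⌈t⌉₊ t (Nat.le_ceil t)).trans ?_
  have hc : (⌈t⌉₊ : ℝ) ≤ t + 1 := by exact_mod_cast (Nat.ceil_lt_add_one t.2).le
  calc M ^ ⌈t⌉₊ = M ^ (⌈t⌉₊ : ℝ) := (Real.rpow_natCast _ _).symm
    _ ≤ M ^ ((t : ℝ) + 1) := Real.rpow_le_rpow_of_exponent_le hM hc
    _ = M * Real.exp (Real.log M * t) := by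
      rw [Real.rpow_add hM0, Real.rpow_one, Real.rpow_def_of_pos hM0, mul_comm]

end Semigroup

/-! ### Concentration at the peak -/

section Peak

/-- Hypothesis `h` says that `b` lies between `a` and `c`, which treats both sides of the peak at
once; the estimate is `1 + u < exp u` with `u = (a - b) / c`. -/
theorem mul_exp_neg_div_lt {a b c : ℝ} (hb : 0 < b) (hc : 0 < c) (hab : a ≠ b)
    (h : 0 ≤ (b - a) * (c - b)) : a * Real.exp (-(a / c)) < b * Real.exp (-(b / c)) := by
  have h0 : (a - b) / c ≠ 0 := div_ne_zero (sub_ne_zero.2 hab) hc.ne'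
  have h1 : a ≤ b * ((a - b) / c + 1) := by
    rw [div_add_one hc.ne', mul_div_assoc', le_div_iff₀ hc]
    nlinarith
  have h2 : a < b * Real.exp ((a - b) / c) :=
    h1.trans_lt (mul_lt_mul_of_pos_left (Real.add_one_lt_exp h0) hb)
  calc a * Real.exp (-(a / c)) < b * Real.exp ((a - b) / c) * Real.exp (-(a / c)) :=
        mul_lt_mul_of_pos_right h2 (Real.exp_pos _)
    _ = b * Real.exp (-(b / c)) := by
        rw [mul_assoc, ← Real.exp_add]
        congr 2
        ring

/-- A continuous integrable function is nonnegative at `c` if its integrals against all powers of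
`t ↦ t exp (-t / c)`, which peaks at `c`, are nonnegative. -/
theorem nonneg_of_integral_mul_exp_pow_nonneg {f : ℝ → ℝ} (hf : Continuous f) {c : ℝ} (hc : 0 < c)
    (hi : IntegrableOn f (Ioi 0))
    (hin : ∀ n : ℕ, IntegrableOn (fun t => (t * Real.exp (-(t / c))) ^ n * f t) (Ioi 0))
    (h : ∀ n : ℕ, 0 ≤ ∫ t in Ioi 0, (t * Real.exp (-(t / c))) ^ n * f t) : 0 ≤ f c := by
  by_contra! hfc
  set w : ℝ → ℝ := fun t => t * Real.exp (-(t / c)) with hw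
  have hwc : Continuous w := by fun_prop
  obtain ⟨ε, hε, hfε⟩ : ∃ ε, 0 < ε ∧ f c < -ε := ⟨-f c / 2, by linarith, by linarith⟩
  obtain ⟨δ₀, hδ₀, hfδ₀⟩ := Metric.eventually_nhds_iff.1 (hf.continuousAt.eventually_lt_const hfε)
  obtain ⟨δ, hδ, hδc, hδ'⟩ : ∃ δ, 0 < δ ∧ δ < c ∧ δ < δ₀ :=
    ⟨min c δ₀ / 2, by positivity, by linarith [min_le_left c δ₀], by linarith [min_le_right c δ₀]⟩
  have hfδ : ∀ t, |t - c| ≤ δ → f t < -ε := fun t ht => hfδ₀ (ht.trans_lt hδ')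
  set q := max (w (c - δ)) (w (c + δ))
  have hq0 : 0 < q := lt_max_of_lt_right (by simp only [hw]; positivity)
  have hqc : q < w c := max_lt
    (mul_exp_neg_div_lt hc hc (by linarith) (by simp)) (mul_exp_neg_div_lt hc hc (by linarith)
      (by simp))
  have hwq : ∀ t, 0 < t → δ < |t - c| → w t ≤ q := by
    intro t ht htc
    rcases lt_abs.1 htc with h | h
    · exact le_max_of_le_right (mul_exp_neg_div_lt (by linarith) hc (by linarith)
        (by nlinarith)).le
    · exact le_max_of_le_left (mul_exp_neg_div_lt (by linarith) hc (by linarith)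
        (by nlinarith)).le
  obtain ⟨r, hqr, hrc⟩ := exists_between hqc
  have hr0 : 0 < r := hq0.trans hqr
  obtain ⟨η₀, hη₀, hwη₀⟩ := Metric.eventually_nhds_iff.1
    (hwc.continuousAt.eventually_const_lt hrc)
  obtain ⟨η, hη, hηδ, hη'⟩ : ∃ η, 0 < η ∧ η < δ ∧ η < η₀ :=
    ⟨min δ η₀ / 2, by positivity, by linarith [min_le_left δ η₀], by linarith [min_le_right δ η₀]⟩
  have hsub : Icc (c - η) (c + η) ⊆ Ioi 0 := fun t ht => by
    have := ht.1
    simp only [mem_Ioi]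
    linarith
  -- Within `η` of `c` the integrand is at most `-ε rⁿ`; between `η` and `δ` it is nonpositive;
  -- beyond `δ`, `w ≤ q < r`.
  have hpt : ∀ n : ℕ, ∀ t ∈ Ioi (0 : ℝ),
      w t ^ n * f t ≤ q ^ n * |f t| - (Icc (c - η) (c + η)).indicator (fun _ => ε * r ^ n) t := by
    intro n t ht
    have ht : 0 < t := ht
    have hwt : 0 ≤ w t := by simp only [hw]; positivity
    have hqn : 0 ≤ q ^ n * |f t| := by positivity
    by_cases htη : t ∈ Icc (c - η) (c + η)
    · rw [indicator_of_mem htη]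
      have h1 : |t - c| ≤ η := by rw [abs_le]; constructor <;> linarith [htη.1, htη.2]
      have h2 : f t < -ε := hfδ t (by linarith)
      have h3 : r < w t := hwη₀ (h1.trans_lt hη')
      have h4 : r ^ n ≤ w t ^ n := by gcongr
      have h5 : 0 < r ^ n := by positivity
      nlinarith
    · rw [indicator_of_notMem htη, sub_zero]
      by_cases htδ : |t - c| ≤ δ
      · have h2 : f t < -ε := hfδ t htδ
        have h5 : 0 ≤ w t ^ n := by positivity
        nlinarith
      · have h4 : w t ^ n ≤ q ^ n := by gcongr; exact hwq t ht (not_le.1 htδ)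
        calc w t ^ n * f t ≤ w t ^ n * |f t| := by gcongr; exact le_abs_self _
          _ ≤ q ^ n * |f t| := by gcongr
  have hcmp : ∀ n : ℕ, ε * (2 * η) ≤ (q / r) ^ n * ∫ t in Ioi 0, |f t| := by
    intro n
    have hii : IntegrableOn ((Icc (c - η) (c + η)).indicator fun _ => ε * r ^ n) (Ioi 0) :=
      ((integrable_indicator_iff measurableSet_Icc).2
        (integrableOn_const (by simp))).integrableOn
    have h1 := (h n).trans (setIntegral_mono_on (hin n) ((hi.abs.const_mul _).sub hii)
      measurableSet_Ioi (hpt n))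
    rw [Pi.sub_def, integral_sub (hi.abs.const_mul _) hii, integral_const_mul,
      setIntegral_indicator measurableSet_Icc, inter_eq_right.2 hsub, setIntegral_const,
      Real.volume_real_Icc_of_le (by linarith), smul_eq_mul] at h1
    rw [div_pow, div_mul_eq_mul_div, le_div_iff₀ (by positivity)]
    linarith
  have hlim : Tendsto (fun n : ℕ => (q / r) ^ n * ∫ t in Ioi 0, |f t|) atTop (𝓝 0) := by
    simpa using (tendsto_pow_atTop_nhds_zero_of_lt_one (by positivity)
      ((div_lt_one hr0).2 hqr)).mul_const (∫ t in Ioi 0, |f t|)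
  have := ge_of_tendsto' hlim hcmp
  have : 0 < ε * (2 * η) := by positivity
  linarith

end Peak

/-! ### Positivity of the Laplace moments -/

section LaplaceMoments

variable {X : Type*} [NormedAddCommGroup X] [NormedSpace ℝ X]

/-- The orbit of `x`, damped by `exp (-ω t)` and extended to negative times by a constant orbit. -/
noncomputable def dampedOrbit (T : ℝ≥0 → X →L[ℝ] X) (ω : ℝ) (x : X) (t : ℝ) : X :=
  Real.exp (-(ω * t)) • T t.toNNReal x

/-- The `n`-th moment `∫₀^∞ tⁿ exp (-ω t) T(t) x dt`. -/
noncomputable def laplaceMoment (T : ℝ≥0 → X →L[ℝ] X) (ω : ℝ) (x : X) (n : ℕ) : X :=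
  ∫ t in Ioi (0 : ℝ), t ^ n • dampedOrbit T ω x t

variable {T : ℝ≥0 → X →L[ℝ] X}

theorem IsC0Semigroup.continuous_dampedOrbit (hT : IsC0Semigroup T) (ω : ℝ) (x : X) :
    Continuous (dampedOrbit T ω x) := by
  have := (hT.continuous_orbit x).comp continuous_real_toNNReal
  exact (by fun_prop : Continuous fun t : ℝ => Real.exp (-(ω * t))).smul this

theorem IsC0Semigroup.integrableOn_pow_smul_dampedOrbit (hT : IsC0Semigroup T) {M a ω : ℝ}
    (hM : ∀ t : ℝ≥0, ‖T t‖ ≤ M * Real.exp (a * t)) (hω : a < ω) (x : X) (n : ℕ) :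
    IntegrableOn (fun t => t ^ n • dampedOrbit T ω x t) (Ioi 0) := by
  have h1 : IntegrableOn (fun t : ℝ => t ^ (n : ℝ) * Real.exp (-(ω - a) * t ^ (1 : ℝ))) (Ioi 0) :=
    integrableOn_rpow_mul_exp_neg_mul_rpow (by linarith [n.cast_nonneg (α := ℝ)]) one_pos
      (by linarith)
  refine Integrable.mono' (h1.const_mul (M * ‖x‖)) ?_ ?_
  · have := hT.continuous_dampedOrbit ω x
    fun_prop
  · refine (ae_restrict_iff' measurableSet_Ioi).2 (Eventually.of_forall fun t ht => ?_)
    have ht : 0 < t := ht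
    have h2 : ‖T t.toNNReal x‖ ≤ M * Real.exp (a * t) * ‖x‖ := by
      refine ((T _).le_opNorm x).trans ?_
      have := hM t.toNNReal
      rw [Real.coe_toNNReal _ ht.le] at this
      gcongr
    rw [dampedOrbit, norm_smul, norm_smul, Real.norm_of_nonneg (by positivity),
      Real.norm_of_nonneg (Real.exp_pos _).le, Real.rpow_natCast, Real.rpow_one]
    calc t ^ n * (Real.exp (-(ω * t)) * ‖T t.toNNReal x‖)
        ≤ t ^ n * (Real.exp (-(ω * t)) * (M * Real.exp (a * t) * ‖x‖)) := by gcongr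
      _ = M * ‖x‖ * (t ^ n * Real.exp (-(ω - a) * t)) := by
        rw [show -(ω - a) * t = -(ω * t) + a * t by ring, Real.exp_add]
        ring

theorem IsGenerator.exists_mem_domain {A : X →ₗ.[ℝ] X} (hA : IsGenerator T A)
    (hT : T 0 = ContinuousLinearMap.id ℝ X) {v y : X}
    (hv : HasDerivWithinAt (fun h : ℝ => T h.toNNReal v) y (Ioi 0) 0) :
    ∃ z : A.domain, (z : X) = v ∧ A z = y := by
  have h1 : Tendsto (fun t : ℝ≥0 => (t : ℝ)⁻¹ • (T t v - v)) (𝓝[>] 0) (𝓝 y) := by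
    have h2 := (hasDerivWithinAt_iff_tendsto_slope' self_notMem_Ioi).1 hv
    rw [← NNReal.coe_zero, ← NNReal.map_coe_nhdsGT, tendsto_map'_iff] at h2
    refine h2.congr fun t => ?_
    simp [slope_def_module, hT]
  have hmem := (hA.mem_domain_iff v).2 ⟨y, h1⟩
  exact ⟨⟨v, hmem⟩, rfl, tendsto_nhds_unique (hA.tendsto_apply ⟨v, hmem⟩) h1⟩

variable [CompleteSpace X]

theorem IsC0Semigroup.apply_laplaceMoment (hT : IsC0Semigroup T) {ω : ℝ} {x : X} {n : ℕ}
    (hi : IntegrableOn (fun t => t ^ n • dampedOrbit T ω x t) (Ioi 0)) {h : ℝ} (hh : 0 ≤ h) :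
    T h.toNNReal (laplaceMoment T ω x n) =
      Real.exp (ω * h) • ∫ t in Ioi h, (t - h) ^ n • dampedOrbit T ω x t := by
  have hshift : ∫ t in Ioi h, (t - h) ^ n • dampedOrbit T ω x t =
      ∫ t in Ioi 0, t ^ n • dampedOrbit T ω x (t + h) := by
    rw [← integral_indicator measurableSet_Ioi, ← integral_indicator measurableSet_Ioi,
      ← integral_add_right_eq_self _ h]
    congr 1 with t
    simp [indicator]
  rw [laplaceMoment, ← (T h.toNNReal).integral_comp_comm hi, hshift, ← integral_smul]
  refine setIntegral_congr_fun measurableSet_Ioi fun t ht => ?_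
  have ht : 0 < t := ht
  simp only [dampedOrbit, map_smul]
  rw [Real.toNNReal_add ht.le hh, add_comm t.toNNReal, hT.map_add, ContinuousLinearMap.comp_apply,
    smul_smul, smul_smul, smul_smul, mul_right_comm, ← Real.exp_add, mul_comm]
  congr 3
  ring

/-- `T(h)` translates the integral, so the orbit of the moment is `exp (ω h)` times a tail integral;
the product rule at `h = 0` yields `ω m_n - y`. -/
theorem IsC0Semigroup.exists_laplaceMoment_eq (hT : IsC0Semigroup T) {A : X →ₗ.[ℝ] X}
    (hA : IsGenerator T A) {ω : ℝ} {x : X} {n : ℕ} {y : X}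
    (hi : IntegrableOn (fun t => t ^ n • dampedOrbit T ω x t) (Ioi 0))
    (hy : HasDerivWithinAt (fun h : ℝ => ∫ t in Ioi h, (t - h) ^ n • dampedOrbit T ω x t)
      (-y) (Ioi 0) 0) :
    ∃ z : A.domain, (z : X) = laplaceMoment T ω x n ∧ ω • (z : X) - A z = y := by
  have he : HasDerivWithinAt (fun h : ℝ => Real.exp (ω * h)) ω (Ioi 0) 0 := by
    have := (((hasDerivAt_id (0 : ℝ)).const_mul ω).exp).hasDerivWithinAt (s := Ioi 0)
    simpa using this
  have h1 : HasDerivWithinAt (fun h : ℝ => T h.toNNReal (laplaceMoment T ω x n))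
      (ω • laplaceMoment T ω x n - y) (Ioi 0) 0 := by
    refine ((he.smul hy).congr_deriv ?_).congr
      (fun h hh => hT.apply_laplaceMoment hi (le_of_lt hh)) (hT.apply_laplaceMoment hi le_rfl)
    simp [laplaceMoment]
    abel
  obtain ⟨z, hz, hAz⟩ := hA.exists_mem_domain hT.map_zero h1
  exact ⟨z, hz, by rw [hAz, hz]; abel⟩

variable [PartialOrder X] [IsOrderedAddMonoid X] [IsOrderedModule ℝ X]

theorem IsC0Semigroup.laplaceMoment_nonneg (hT : IsC0Semigroup T) {A : X →ₗ.[ℝ] X}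
    (hA : IsGenerator T A) {Φ : Set (StrongDual ℝ X)} (hΦ : IsTotal Φ)
    (hdiss : ∀ φ ∈ Φ, IsDissipative (pFun φ) A) {M a ω : ℝ}
    (hM : ∀ t : ℝ≥0, ‖T t‖ ≤ M * Real.exp (a * t)) (ha : a < ω) (hω : 0 < ω) {x : X}
    (hx : 0 ≤ x) (n : ℕ) : 0 ≤ laplaceMoment T ω x n := by
  have hi := hT.integrableOn_pow_smul_dampedOrbit hM ha x
  have hpos : ∀ z : A.domain, 0 ≤ ω • (z : X) - A z → 0 ≤ (z : X) := fun z hz =>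
    hΦ.nonneg_of_forall _ fun φ hφ =>
      (hdiss φ hφ).apply_nonneg (hΦ.subset_dualCone hφ) hω z hz
  have hg := hT.continuous_dampedOrbit ω x
  induction n with
  | zero =>
    obtain ⟨z, hz, hAz⟩ := hT.exists_laplaceMoment_eq (y := x) hA (hi 0) <| by
      have := hasDerivWithinAt_integral_Ioi hg (by simpa using hi 0)
      simpa [dampedOrbit, hT.map_zero] using this
    rw [← hz]
    exact hpos z (hAz ▸ hx)
  | succ n ih =>
    obtain ⟨z, hz, hAz⟩ := hT.exists_laplaceMoment_eq hA (hi (n + 1))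
      (hasDerivWithinAt_integral_Ioi_sub_pow_smul hg n (hi n) (hi (n + 1)))
    rw [← hz]
    refine hpos z ?_
    rw [hAz]
    exact smul_nonneg (by positivity) ih

end LaplaceMoments

end OrderedSemigroup

/-! ### Positivity of the semigroup -/

open MeasureTheory Set OrderedSemigroup in
theorem mainTheorem1 {X : Type*} [NormedAddCommGroup X] [NormedSpace ℝ X] [CompleteSpace X]
    [PartialOrder X] [IsOrderedAddMonoid X] [IsOrderedModule ℝ X]
    (T : ℝ≥0 → X →L[ℝ] X) (hT : OrderedSemigroup.IsC0Semigroup T)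
    (A : X →ₗ.[ℝ] X) (hA : OrderedSemigroup.IsGenerator T A)
    (Φ : Set (StrongDual ℝ X)) (hΦ : OrderedSemigroup.IsTotal Φ)
    (hdiss : ∀ φ ∈ Φ, OrderedSemigroup.IsDissipative (OrderedSemigroup.pFun φ) A)
    (hinv : ∃ l : ℝ, 0 ≤ l ∧
      Function.Bijective (fun x : A.domain => (x : X) - l • A x)) :
    ∀ t : ℝ≥0, ∀ x : X, 0 ≤ x → 0 ≤ T t x := by
  intro s x hx
  obtain ⟨M, a, -, ha, hM⟩ := hT.exists_norm_le_exp
  rcases eq_or_ne s 0 with rfl | hs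
  · simpa [hT.map_zero] using hx
  have hs : (0 : ℝ) < s := by positivity
  refine hΦ.nonneg_of_forall _ fun φ hφ => ?_
  -- Damping by `a + 1` exceeds the growth rate, so the orbit is integrable already for `n = 0`.
  have hi := hT.integrableOn_pow_smul_dampedOrbit (ω := a + 1) hM (by linarith) x
  have hexp : ∀ (n : ℕ) (t : ℝ), (t * Real.exp (-(t / s))) ^ n * φ (dampedOrbit T (a + 1) x t) =
      φ (t ^ n • dampedOrbit T (n / s + (a + 1)) x t) := by
    intro n t
    simp only [dampedOrbit, map_smul, smul_eq_mul, mul_pow, ← Real.exp_nat_mul]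
    rw [show -((n / s + (a + 1)) * t) = n * -(t / s) + -((a + 1) * t) by ring, Real.exp_add]
    ring
  have hω : ∀ n : ℕ, a < n / s + (a + 1) := fun n => by
    have : (0 : ℝ) ≤ n / s := by positivity
    linarith
  have hin := fun n : ℕ => hT.integrableOn_pow_smul_dampedOrbit hM (hω n) x n
  have hfin : 0 ≤ φ (dampedOrbit T (a + 1) x s) := by
    refine nonneg_of_integral_mul_exp_pow_nonneg (f := fun t => φ (dampedOrbit T (a + 1) x t))
      (φ.continuous.comp (hT.continuous_dampedOrbit _ x)) hs ?_ (fun n => ?_) fun n => ?_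
    · exact φ.integrable_comp (by simpa [IntegrableOn] using hi 0)
    · simp only [hexp]
      exact φ.integrable_comp (hin n)
    · simp only [hexp]
      rw [φ.integral_comp_comm (hin n)]
      exact hΦ.subset_dualCone hφ _ (hT.laplaceMoment_nonneg hA hΦ hdiss hM (hω n)
        (ha.trans_lt (hω n)) hx n)
  rw [dampedOrbit, Real.toNNReal_coe, map_smul, smul_eq_mul] at hfin
  exact nonneg_of_mul_nonneg_right hfin (Real.exp_pos _)
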